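/- Let $k\ge 2$ and let $\beta_0<\beta_1<\dots<\beta_{k-1}<\beta_0+1=:\beta_k$ be real numbers, so that the half-open intervals $I_i=[\beta_i,\beta_{i+1}[$, $0\le i\le k-1$, taken modulo $1$, form a partition of the circle $\mathbb{R}/\mathbb{Z}$ into $k$ intervals of lengths $\lambda_i=\beta_{i+1}-\beta_i$. Assume that $\lambda_0,\dots,\lambda_{k-1}$ are linearly independent over $\mathbb{Q}$, and let $\alpha=\lambda_i$ or $\alpha=-\lambda_i$ for some $i$ (so $\alpha$ is irrational). For $x\in\mathbb{R}/\mathbb{Z}$ let $U=(U_n)_{n\ge 0}$ be the infinite word over $\{0,\dots,k-1\}$ that codes the positive orbit of $x$ under the rotation by $\alpha$, that is, $U_n=j$ if and only if $x+n\alpha\in I_j$ modulo $1$. Then $U$ is recurrent (every factor of $U$ occurs infinitely many times in $U$) and has property $R_k$: for every factor $w$ of $U$ there are exactly $k$ distinct return words over $w$, where a return word over $w$ is a word $U_mU_{m+1}\cdots U_{m'-1}$ such that $m<m'$ are two consecutive positions of occurrence of $w$ in $U$. -/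

import Mathlib

/-! ### Infinite words, factors and return words -/

/-- The finite word `U_i U_{i+1} ⋯ U_{i+n-1}` of the infinite word `U`. -/
def wordSegment {A : Type*} (U : ℕ → A) (i n : ℕ) : List A :=
  List.ofFn (fun j : Fin n => U (i + j))

/-- The finite word `w` occurs in `U` at position `i`. -/
def OccursAt {A : Type*} (U : ℕ → A) (w : List A) (i : ℕ) : Prop :=
  wordSegment U i w.length = w

/-- The language `L(U)`: the set of factors of `U` (of all lengths). -/
def factorSet {A : Type*} (U : ℕ → A) : Set (List A) :=
  {w | ∃ i, OccursAt U w i}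

/-- `U` is recurrent: every factor of `U` occurs infinitely many times in `U`. -/
def IsRecurrentWord {A : Type*} (U : ℕ → A) : Prop :=
  ∀ w ∈ factorSet U, {i | OccursAt U w i}.Infinite

/-- The set of return words over `w` in `U`: all words `U_i U_{i+1} ⋯ U_{j-1}` where `i < j` are
two consecutive positions of occurrence of `w` in `U`. -/
def returnWords {A : Type*} (U : ℕ → A) (w : List A) : Set (List A) :=
  {v | ∃ i j, i < j ∧ OccursAt U w i ∧ OccursAt U w j ∧
    (∀ m, i < m → m < j → ¬ OccursAt U w m) ∧ v = wordSegment U i (j - i)}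

/-- Property `R_n`: every factor of `U` has exactly `n` return words. -/
def HasPropertyR {A : Type*} (n : ℕ) (U : ℕ → A) : Prop :=
  ∀ w ∈ factorSet U, (returnWords U w).encard = n

/-! ### Partitions of the circle and codings of rotations -/

/-- A partition of the circle `ℝ/ℤ` by `p ≥ 2` consecutive points, given by real lifts
`β_0 < β_1 < ⋯ < β_{p-1} < β_0 + 1`. -/
structure CirclePartition (p : ℕ) where
  two_le : 2 ≤ p
  pt : Fin p → ℝ
  strictMono : StrictMono pt
  lt_add_one : ∀ i j, pt i < pt j + 1

namespace CirclePartition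

variable {p : ℕ}

/-- The index of the first point `β_0`. -/
def first (P : CirclePartition p) : Fin p := ⟨0, lt_of_lt_of_le Nat.zero_lt_two P.two_le⟩

/-- The right end of the `i`-th interval: `β_{i+1}`, or (a lift of) `β_p = β_0` if `i = p - 1`. -/
noncomputable def rightEnd (P : CirclePartition p) (i : Fin p) : ℝ :=
  if h : (i : ℕ) + 1 < p then P.pt ⟨i + 1, h⟩ else P.pt P.first + 1

/-- The length of the `i`-th interval. -/
noncomputable def length (P : CirclePartition p) (i : Fin p) : ℝ := P.rightEnd i - P.pt i

/-- The `i`-th interval `[β_i, β_{i+1}[` of the circle. -/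
def arc (P : CirclePartition p) (i : Fin p) : Set UnitAddCircle :=
  (fun t : ℝ => (t : UnitAddCircle)) '' Set.Ico (P.pt i) (P.rightEnd i)

theorem rightEnd_le_pt (P : CirclePartition p) {i j : Fin p} (h : i < j) :
    P.rightEnd i ≤ P.pt j := by
  have hij : (i : ℕ) < j := h
  have h1 : (i : ℕ) + 1 < p := lt_of_le_of_lt hij j.2
  rw [rightEnd, dif_pos h1]
  exact P.strictMono.monotone (Fin.le_def.2 hij)

theorem pt_first_le (P : CirclePartition p) (i : Fin p) : P.pt P.first ≤ P.pt i :=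
  P.strictMono.monotone (Fin.le_def.2 (Nat.zero_le _))

theorem rightEnd_le (P : CirclePartition p) (i : Fin p) :
    P.rightEnd i ≤ P.pt P.first + 1 := by
  unfold rightEnd
  split_ifs with h
  · exact (P.lt_add_one _ _).le
  · exact le_rfl

theorem eq_of_mem_Ico (P : CirclePartition p) {i j : Fin p} {t : ℝ}
    (hi : t ∈ Set.Ico (P.pt i) (P.rightEnd i)) (hj : t ∈ Set.Ico (P.pt j) (P.rightEnd j)) :
    i = j := by
  rcases lt_trichotomy i j with h | h | h
  · exact absurd (lt_of_lt_of_le hi.2 (P.rightEnd_le_pt h)) (not_lt.2 hj.1)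
  · exact h
  · exact absurd (lt_of_lt_of_le hj.2 (P.rightEnd_le_pt h)) (not_lt.2 hi.1)

/-- The intervals form a partition of the circle. -/
theorem existsUnique_arc (P : CirclePartition p) (y : UnitAddCircle) :
    ∃! i, y ∈ P.arc i := by
  classical
  have : Fact ((0 : ℝ) < 1) := ⟨one_pos⟩
  refine existsUnique_of_exists_of_unique ?_ ?_
  · obtain ⟨t, ht, rfl⟩ : ∃ t ∈ Set.Ico (P.pt P.first) (P.pt P.first + 1),
        (t : UnitAddCircle) = y :=
      ⟨(AddCircle.equivIco 1 (P.pt P.first) y : ℝ), (AddCircle.equivIco 1 (P.pt P.first) y).2,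
        (AddCircle.equivIco 1 (P.pt P.first)).symm_apply_apply y⟩
    have hne : (Finset.univ.filter (fun i => P.pt i ≤ t)).Nonempty :=
      ⟨P.first, by simpa using ht.1⟩
    set i := (Finset.univ.filter (fun i => P.pt i ≤ t)).max' hne with hi
    have hmem : P.pt i ≤ t := by
      have := Finset.max'_mem _ hne
      simpa using (Finset.mem_filter.1 this).2
    refine ⟨i, t, ⟨hmem, ?_⟩, rfl⟩
    unfold rightEnd
    split_ifs with h
    · by_contra hcon
      have hle : (⟨i + 1, h⟩ : Fin p) ≤ i :=
        Finset.le_max' (Finset.univ.filter (fun i => P.pt i ≤ t)) _ (Finset.mem_filter.2 ⟨Finset.mem_univ _, not_lt.1 hcon⟩)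
      have : (i : ℕ) + 1 ≤ i := hle
      omega
    · exact ht.2
  · rintro i j ⟨s, hs, hsy⟩ ⟨t, ht, hty⟩
    have hs' : s ∈ Set.Ico (P.pt P.first) (P.pt P.first + 1) :=
      ⟨(P.pt_first_le i).trans hs.1, lt_of_lt_of_le hs.2 (P.rightEnd_le i)⟩
    have ht' : t ∈ Set.Ico (P.pt P.first) (P.pt P.first + 1) :=
      ⟨(P.pt_first_le j).trans ht.1, lt_of_lt_of_le ht.2 (P.rightEnd_le j)⟩
    have hst : s = t :=
      (AddCircle.coe_eq_coe_iff_of_mem_Ico hs' ht').1 (hsy.trans hty.symm)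
    subst hst
    exact P.eq_of_mem_Ico hs ht

/-- The index of the interval that contains the point `y` of the circle. -/
noncomputable def letter (P : CirclePartition p) (y : UnitAddCircle) : Fin p :=
  (P.existsUnique_arc y).choose

/-- The coding of the positive orbit of `x` under the rotation by angle `α`, with respect to the
partition `P`. -/
noncomputable def coding (P : CirclePartition p) (α : ℝ) (x : UnitAddCircle) : ℕ → Fin p :=
  fun n => P.letter (x + n • (α : UnitAddCircle))

theorem letter_eq_iff (P : CirclePartition p) (y : UnitAddCircle) (i : Fin p) :
    P.letter y = i ↔ y ∈ P.arc i := by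
  constructor
  · rintro rfl
    exact (P.existsUnique_arc y).choose_spec.1
  · intro h
    exact ((P.existsUnique_arc y).choose_spec.2 i h).symm

/-- The defining property of the coding: `u_n = i` if and only if `x + nα ∈ [β_i, β_{i+1}[`. -/
theorem coding_eq_iff (P : CirclePartition p) (α : ℝ) (x : UnitAddCircle) (n : ℕ) (i : Fin p) :
    P.coding α x n = i ↔ x + n • (α : UnitAddCircle) ∈ P.arc i :=
  P.letter_eq_iff _ i

end CirclePartition

/-!
The points sharing a coding of length `n` form an arc whose left end is a point where the coding can
change, that is, a point of one of the backward orbits of the division points up to time `n`. The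
rotation by `α` maps some division point `b_s` to another one `b_t`, and rational independence
excludes every other coincidence between these orbits. That single connection forces distinct left
ends to have distinct codings, so the cylinder of a factor `w` contains exactly one left end `a` of
the codings of length `|w|`.

The return words over `w` are in bijection with the left ends, inside the cylinder of `w`, of the
sets of points with the same coding until the end of their first return. These are `a` and, for
every `j ≠ s`, the first point other than `a` at which the backward orbit of `b_j` visits the
cylinder: from any later visit the orbit returns and reads `w` again before it meets `b_j`. Hence
there are `1 + (k - 1) = k` return words.
-/

/-! ### Itineraries -/

section Itinerary

variable {X A : Type*}

/-- The itinerary of `x` under the map `T`, read through the labelling `ℓ` of the phase space. -/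
def itinerary (T : X → X) (ℓ : X → A) (x : X) : ℕ → A := fun n => ℓ (T^[n] x)

/-- The first `n` letters of the itinerary of `x`. -/
def orbitWord (T : X → X) (ℓ : X → A) (n : ℕ) (x : X) : List A :=
  List.ofFn fun m : Fin n => ℓ (T^[m] x)

/-- The cylinder of the word `w`: the points whose itinerary starts with `w`. -/
def cylinder (T : X → X) (ℓ : X → A) (w : List A) : Set X := {x | orbitWord T ℓ w.length x = w}

/-- The first return time of `c` to `S` under `T`; it is `0` if the orbit of `c` never returns. -/
noncomputable def returnTime (T : X → X) (S : Set X) (c : X) : ℕ :=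
  sInf {m | 0 < m ∧ T^[m] c ∈ S}

/-- The symbolic counterpart of minimality: every orbit visits every nonempty cylinder infinitely
often. -/
def IsSymbolicallyMinimal (T : X → X) (ℓ : X → A) : Prop :=
  ∀ w, (cylinder T ℓ w).Nonempty → ∀ x, ∃ᶠ m in Filter.atTop, T^[m] x ∈ cylinder T ℓ w

variable {T : X → X} {ℓ : X → A} {S : Set X} {w : List A} {x y z c : X} {m n r : ℕ}

@[simp]
theorem length_orbitWord : (orbitWord T ℓ n x).length = n := List.length_ofFn

theorem orbitWord_eq_orbitWord_iff :
    orbitWord T ℓ n x = orbitWord T ℓ n y ↔ ∀ m < n, ℓ (T^[m] x) = ℓ (T^[m] y) := by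
  rw [orbitWord, orbitWord, List.ofFn_injective.eq_iff, funext_iff]
  exact Fin.forall_iff

theorem orbitWord_eq_of_le (hmn : m ≤ n) (h : orbitWord T ℓ n x = orbitWord T ℓ n y) :
    orbitWord T ℓ m x = orbitWord T ℓ m y :=
  orbitWord_eq_orbitWord_iff.2 fun i hi => orbitWord_eq_orbitWord_iff.1 h i (hi.trans_le hmn)

theorem orbitWord_add (r n : ℕ) (x : X) :
    orbitWord T ℓ (r + n) x = orbitWord T ℓ r x ++ orbitWord T ℓ n (T^[r] x) := by
  simp [orbitWord, List.ofFn_add, ← Function.iterate_add_apply, add_comm]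

theorem orbitWord_add_eq_iff : orbitWord T ℓ (r + n) x = orbitWord T ℓ (r + n) y ↔
    orbitWord T ℓ r x = orbitWord T ℓ r y ∧
      orbitWord T ℓ n (T^[r] x) = orbitWord T ℓ n (T^[r] y) := by
  rw [orbitWord_add, orbitWord_add, List.append_eq_append_iff_of_size_eq_left (by simp)]

theorem mem_cylinder_orbitWord : y ∈ cylinder T ℓ (orbitWord T ℓ n x) ↔
    orbitWord T ℓ n y = orbitWord T ℓ n x := by
  simp [cylinder]

theorem orbitWord_eq_of_mem_cylinder (hx : x ∈ cylinder T ℓ w) (hy : y ∈ cylinder T ℓ w) :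
    orbitWord T ℓ w.length x = orbitWord T ℓ w.length y :=
  hx.trans hy.symm

theorem mem_cylinder_congr (h : orbitWord T ℓ w.length x = orbitWord T ℓ w.length y) :
    x ∈ cylinder T ℓ w ↔ y ∈ cylinder T ℓ w :=
  Eq.congr_left h

theorem isLeast_returnTime (h : ∃ m, 0 < m ∧ T^[m] c ∈ S) :
    IsLeast {m | 0 < m ∧ T^[m] c ∈ S} (returnTime T S c) :=
  isLeast_csInf h

theorem returnTime_cylinder_congr (hc : ∃ m, 0 < m ∧ T^[m] c ∈ cylinder T ℓ w)
    (h : orbitWord T ℓ (returnTime T (cylinder T ℓ w) c + w.length) c =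
      orbitWord T ℓ (returnTime T (cylinder T ℓ w) c + w.length) z) :
    returnTime T (cylinder T ℓ w) z = returnTime T (cylinder T ℓ w) c := by
  obtain ⟨⟨hpos, hmem⟩, hmin⟩ := isLeast_returnTime hc
  have hvisit : ∀ m ≤ returnTime T (cylinder T ℓ w) c,
      (T^[m] c ∈ cylinder T ℓ w ↔ T^[m] z ∈ cylinder T ℓ w) := fun m hm =>
    mem_cylinder_congr (orbitWord_add_eq_iff.1 (orbitWord_eq_of_le (by gcongr) h)).2
  refine IsLeast.csInf_eq ⟨⟨hpos, (hvisit _ le_rfl).1 hmem⟩, fun m hm => ?_⟩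
  by_contra! hlt
  exact hlt.not_ge (hmin ⟨hm.1, (hvisit m hlt.le).2 hm.2⟩)

theorem wordSegment_itinerary (i n : ℕ) :
    wordSegment (itinerary T ℓ x) i n = orbitWord T ℓ n (T^[i] x) := by
  simp only [wordSegment, itinerary, orbitWord, add_comm i, Function.iterate_add_apply]

theorem occursAt_itinerary_iff {i : ℕ} :
    OccursAt (itinerary T ℓ x) w i ↔ T^[i] x ∈ cylinder T ℓ w := by
  rw [OccursAt, wordSegment_itinerary]; rfl

namespace IsSymbolicallyMinimal

theorem exists_pos_iterate_mem_cylinder (hT : IsSymbolicallyMinimal T ℓ)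
    (hw : (cylinder T ℓ w).Nonempty) (c : X) : ∃ m, 0 < m ∧ T^[m] c ∈ cylinder T ℓ w :=
  Filter.frequently_atTop'.1 (hT w hw c) 0

theorem isRecurrentWord_itinerary (hT : IsSymbolicallyMinimal T ℓ) (x : X) :
    IsRecurrentWord (itinerary T ℓ x) := by
  rintro w ⟨i, hi⟩
  simp only [occursAt_itinerary_iff] at hi ⊢
  exact Nat.frequently_atTop_iff_infinite.1 (hT w ⟨_, hi⟩ x)

theorem mem_returnWords_itinerary_iff (hT : IsSymbolicallyMinimal T ℓ) {v : List A} :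
    v ∈ returnWords (itinerary T ℓ x) w ↔ ∃ i, T^[i] x ∈ cylinder T ℓ w ∧
      orbitWord T ℓ (returnTime T (cylinder T ℓ w) (T^[i] x)) (T^[i] x) = v := by
  simp only [returnWords, Set.mem_ofPred_eq, occursAt_itinerary_iff, wordSegment_itinerary]
  constructor
  · rintro ⟨i, j, hij, hi, hj, hbetween, rfl⟩
    obtain ⟨r, rfl⟩ := Nat.exists_eq_add_of_le' hij.le
    have hr : returnTime T (cylinder T ℓ w) (T^[i] x) = r := by
      refine IsLeast.csInf_eq ⟨⟨by omega, ?_⟩, fun m ⟨hm, hmem⟩ => ?_⟩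
      · rwa [← Function.iterate_add_apply]
      · by_contra! hlt
        rw [← Function.iterate_add_apply] at hmem
        exact hbetween (m + i) (by omega) (by omega) hmem
    exact ⟨i, hi, by rw [hr, Nat.add_sub_cancel]⟩
  · rintro ⟨i, hi, rfl⟩
    obtain ⟨⟨hpos, hmem⟩, hmin⟩ :=
      isLeast_returnTime (hT.exists_pos_iterate_mem_cylinder ⟨_, hi⟩ (T^[i] x))
    set r := returnTime T (cylinder T ℓ w) (T^[i] x)
    refine ⟨i, r + i, by omega, hi, ?_, fun m him hmr hm => ?_, by rw [Nat.add_sub_cancel]⟩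
    · rwa [Function.iterate_add_apply]
    · obtain ⟨q, rfl⟩ := Nat.exists_eq_add_of_le' him.le
      rw [Function.iterate_add_apply] at hm
      have := hmin ⟨by omega, hm⟩
      omega

theorem returnWords_itinerary (hT : IsSymbolicallyMinimal T ℓ) (x : X) (w : List A) :
    returnWords (itinerary T ℓ x) w =
      (fun c => orbitWord T ℓ (returnTime T (cylinder T ℓ w) c) c) '' cylinder T ℓ w := by
  ext v
  rw [hT.mem_returnWords_itinerary_iff]
  constructor
  · rintro ⟨i, hi, rfl⟩
    exact ⟨_, hi, rfl⟩
  · rintro ⟨c, hc, rfl⟩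
    set r := returnTime T (cylinder T ℓ w) c
    obtain ⟨i, hi⟩ :=
      (hT (orbitWord T ℓ (r + w.length) c) ⟨c, mem_cylinder_orbitWord.2 rfl⟩ x).exists
    rw [mem_cylinder_orbitWord] at hi
    have hret := returnTime_cylinder_congr (hT.exists_pos_iterate_mem_cylinder ⟨c, hc⟩ c) hi.symm
    refine ⟨i, (mem_cylinder_congr (orbitWord_eq_of_le (Nat.le_add_left _ _) hi)).2 hc, ?_⟩
    rw [hret]
    exact orbitWord_eq_of_le (Nat.le_add_right _ _) hi

end IsSymbolicallyMinimal

end Itinerary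

/-! ### Oriented arcs of the circle -/

section CircleGap

variable {𝕜 : Type*} [AddCommGroup 𝕜] [LinearOrder 𝕜] [IsOrderedAddMonoid 𝕜] [Archimedean 𝕜]
  {p : 𝕜} [Fact (0 < p)]

/-- The length of the positively oriented arc of the circle that goes from `x` to `y`. -/
noncomputable def circleGap (x y : AddCircle p) : 𝕜 := AddCircle.equivIco p 0 (y - x)

theorem circleGap_nonneg (x y : AddCircle p) : 0 ≤ circleGap x y :=
  (AddCircle.equivIco p 0 (y - x)).2.1

theorem circleGap_lt (x y : AddCircle p) : circleGap x y < p :=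
  (AddCircle.equivIco p 0 (y - x)).2.2.trans_eq (zero_add p)

theorem coe_circleGap (x y : AddCircle p) : ((circleGap x y : 𝕜) : AddCircle p) = y - x :=
  AddCircle.coe_equivIco

theorem circleGap_eq_of_coe_eq {x y : AddCircle p} {t : 𝕜} (h0 : 0 ≤ t) (h1 : t < p)
    (h : (t : AddCircle p) = y - x) : circleGap x y = t := by
  rw [circleGap, ← h]
  exact AddCircle.equivIco_coe_of_mem ⟨h0, by rwa [zero_add]⟩

theorem circleGap_coe_coe {a b : 𝕜} (hab : a ≤ b) (hba : b < a + p) :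
    circleGap (a : AddCircle p) b = b - a :=
  circleGap_eq_of_coe_eq (sub_nonneg.2 hab) (sub_lt_iff_lt_add'.2 hba) (AddCircle.coe_sub p _ _)

theorem circleGap_self (x : AddCircle p) : circleGap x x = 0 :=
  circleGap_eq_of_coe_eq le_rfl Fact.out (by simp)

theorem circleGap_add_right (x y z : AddCircle p) :
    circleGap (x + z) (y + z) = circleGap x y := by
  simp [circleGap]

theorem circleGap_sub_left (x y z : AddCircle p) : circleGap (x - z) y = circleGap x (y + z) := by
  rw [← circleGap_add_right _ _ z, sub_add_cancel]

theorem eq_of_circleGap_eq_circleGap {x x' y : AddCircle p}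
    (h : circleGap x y = circleGap x' y) : x = x' := by
  have := congrArg (fun t : 𝕜 => (t : AddCircle p)) h
  simpa only [coe_circleGap, sub_right_inj] using this

theorem eq_of_circleGap_eq_zero {x y : AddCircle p} (h : circleGap x y = 0) : x = y :=
  eq_of_circleGap_eq_circleGap (h.trans (circleGap_self y).symm)

theorem circleGap_add_circleGap {x y z : AddCircle p} (h : circleGap y z ≤ circleGap x z) :
    circleGap x y + circleGap y z = circleGap x z := by
  rw [← eq_sub_iff_add_eq]
  refine circleGap_eq_of_coe_eq (sub_nonneg.2 h) ?_ ?_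
  · exact (sub_le_self _ (circleGap_nonneg y z)).trans_lt (circleGap_lt x z)
  · rw [AddCircle.coe_sub, coe_circleGap, coe_circleGap, sub_sub_sub_cancel_left]

theorem eq_of_circleGap_le_of_circleGap_le {x y z : AddCircle p}
    (hyz : circleGap y z ≤ circleGap x z) (hzy : circleGap z y ≤ circleGap x y) : y = z := by
  have hxyz := circleGap_add_circleGap hyz
  have hxzy := circleGap_add_circleGap hzy
  refine eq_of_circleGap_eq_zero (le_antisymm ?_ (circleGap_nonneg y z))
  rw [← hxyz, add_assoc, add_eq_left] at hxzy
  rw [← hxzy]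
  exact le_add_of_nonneg_right (circleGap_nonneg z y)

theorem frequently_circleGap_add_nsmul_mem_Ioo {p : ℝ} [Fact (0 < p)] {θ : AddCircle p}
    (hθ : ¬IsOfFinAddOrder θ) (x y : AddCircle p) {ε : ℝ} (hε : 0 < ε) :
    ∃ᶠ n : ℕ in Filter.atTop, circleGap y (x + n • θ) ∈ Set.Ioo 0 ε := by
  have hdense : DenseRange (fun n : ℕ => n • θ) :=
    denseRange_zsmul_iff_nsmul.1 (AddCircle.denseRange_zsmul_iff.2 (addOrderOf_eq_zero hθ))
  have hp : 0 < p := Fact.out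
  let V : Set (AddCircle p) := (fun t : ℝ => (t : AddCircle p)) '' Set.Ioo 0 (min ε p)
  have hV : IsOpen V := QuotientAddGroup.isOpenMap_coe _ isOpen_Ioo
  obtain ⟨v, hv⟩ : V.Nonempty := (Set.nonempty_Ioo.2 (lt_min hε hp)).image _
  refine Filter.frequently_atTop.2 fun N => ?_
  obtain ⟨n, t, ht, htn⟩ := hdense.exists_mem_open
    (hV.preimage (f := fun z => x + N • θ + z - y) (by fun_prop))
    ⟨v + y - (x + N • θ), by simpa using hv⟩
  have hgap : circleGap y (x + (N + n) • θ) = t :=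
    circleGap_eq_of_coe_eq ht.1.le (ht.2.trans_le (min_le_right _ _)) (by
      rw [add_nsmul, ← add_assoc]; exact htn)
  exact ⟨N + n, Nat.le_add_right N n, hgap ▸ ⟨ht.1, ht.2.trans_le (min_le_left _ _)⟩⟩

end CircleGap

namespace CirclePartition

variable {k : ℕ}

/-! ### The division points and the letter of a point -/

/-- The `i`-th division point of the circle. -/
noncomputable def point (P : CirclePartition k) (i : Fin k) : UnitAddCircle := (P.pt i : ℝ)

theorem point_injective (P : CirclePartition k) : Function.Injective P.point := fun i j h =>
  P.strictMono.injective ((AddCircle.coe_eq_coe_iff_of_mem_Ico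
    ⟨P.pt_first_le i, P.lt_add_one i _⟩ ⟨P.pt_first_le j, P.lt_add_one j _⟩).1 h)

theorem exists_coe_eq_mem_Ico_letter (P : CirclePartition k) (y : UnitAddCircle) :
    ∃ t ∈ Set.Ico (P.pt (P.letter y)) (P.rightEnd (P.letter y)), (t : UnitAddCircle) = y :=
  (P.letter_eq_iff y _).1 rfl

theorem circleGap_letter_le (P : CirclePartition k) (y : UnitAddCircle) (l : Fin k) :
    circleGap (P.point (P.letter y)) y ≤ circleGap (P.point l) y := by
  obtain ⟨t, ⟨hjt, htr⟩, hty⟩ := P.exists_coe_eq_mem_Ico_letter y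
  set j := P.letter y
  have hj := P.pt_first_le j
  have hr := P.rightEnd_le j
  have hl := P.pt_first_le l
  have hl1 := P.lt_add_one l P.first
  have hgapj : circleGap (P.point j) y = t - P.pt j := by
    rw [← hty]; exact circleGap_coe_coe hjt (by linarith)
  rcases le_or_gt l j with hlj | hjl
  · have hpt := P.strictMono.monotone hlj
    have hgapl : circleGap (P.point l) y = t - P.pt l := by
      rw [← hty]; exact circleGap_coe_coe (by linarith) (by linarith)
    linarith
  · have hpt := P.rightEnd_le_pt hjl
    have hgapl : circleGap (P.point l) y = t + 1 - P.pt l := by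
      rw [← hty, ← AddCircle.coe_add_period]
      exact circleGap_coe_coe (by linarith) (by linarith)
    linarith

theorem letter_eq_of_circleGap_le (P : CirclePartition k) {y : UnitAddCircle} {j : Fin k}
    (h : ∀ l, circleGap (P.point j) y ≤ circleGap (P.point l) y) : P.letter y = j :=
  P.point_injective (eq_of_circleGap_eq_circleGap
    (le_antisymm (P.circleGap_letter_le y j) (h (P.letter y))))

theorem letter_point (P : CirclePartition k) (j : Fin k) : P.letter (P.point j) = j :=
  P.letter_eq_of_circleGap_le fun _ => (circleGap_self _).trans_le (circleGap_nonneg _ _)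

theorem exists_forall_circleGap_lt_letter_eq (P : CirclePartition k) (y : UnitAddCircle) :
    ∃ ε > 0, ∀ z, circleGap y z < ε → P.letter z = P.letter y := by
  obtain ⟨t, ⟨hjt, htr⟩, hty⟩ := P.exists_coe_eq_mem_Ico_letter y
  refine ⟨P.rightEnd (P.letter y) - t, sub_pos.2 htr, fun z hz => ?_⟩
  rw [letter_eq_iff]
  refine ⟨t + circleGap y z, ⟨?_, lt_sub_iff_add_lt'.1 hz⟩, ?_⟩
  · exact le_add_of_le_of_nonneg hjt (circleGap_nonneg y z)
  · simp only [AddCircle.coe_add, hty, coe_circleGap, add_sub_cancel]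

/-! ### Codings of the rotation -/

variable {P : CirclePartition k} {θ φ : UnitAddCircle} {n m : ℕ} {c y z : UnitAddCircle}
  {w : List (Fin k)}

theorem coding_eq_itinerary (P : CirclePartition k) (α : ℝ) (x : UnitAddCircle) :
    P.coding α x = itinerary (· + (α : UnitAddCircle)) P.letter x := by
  funext n
  rw [coding, itinerary, add_right_iterate_apply]

theorem iterate_add_right_sub_nsmul {G : Type*} [AddCommGroup G] (g y : G) (h : m ≤ n) :
    (· + g)^[m] (y - n • g) = y - (n - m) • g := by
  rw [add_right_iterate_apply, sub_nsmul _ h]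
  abel

theorem orbitWord_rotation_eq_iff :
    orbitWord (· + θ) P.letter n y = orbitWord (· + θ) P.letter n z ↔
      ∀ m < n, P.letter (y + m • θ) = P.letter (z + m • θ) := by
  simp only [orbitWord_eq_orbitWord_iff, add_right_iterate]

theorem orbitWord_rotation_succ_eq_iff :
    orbitWord (· + θ) P.letter (n + 1) y = orbitWord (· + θ) P.letter (n + 1) z ↔
      P.letter y = P.letter z ∧
        orbitWord (· + θ) P.letter n (y + θ) = orbitWord (· + θ) P.letter n (z + θ) := by
  rw [add_comm, orbitWord_add_eq_iff]
  simp [orbitWord]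

theorem exists_forall_circleGap_lt_orbitWord_eq (P : CirclePartition k) (θ y : UnitAddCircle)
    (n : ℕ) : ∃ ε > 0, ∀ z, circleGap y z < ε →
      orbitWord (· + θ) P.letter n z = orbitWord (· + θ) P.letter n y := by
  simp only [orbitWord_rotation_eq_iff]
  induction n with
  | zero => exact ⟨1, one_pos, fun _ _ _ hm => absurd hm (Nat.not_lt_zero _)⟩
  | succ n ih =>
    obtain ⟨ε, hε, hε_letter⟩ := ih
    obtain ⟨δ, hδ, hδ_letter⟩ := P.exists_forall_circleGap_lt_letter_eq (y + n • θ)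
    refine ⟨min ε δ, lt_min hε hδ, fun z hz m hm => ?_⟩
    rcases Nat.lt_succ_iff_lt_or_eq.1 hm with hm | rfl
    · exact hε_letter z (hz.trans_le (min_le_left _ _)) m hm
    · refine hδ_letter _ ?_
      rw [circleGap_add_right]
      exact hz.trans_le (min_le_right _ _)

theorem frequently_add_nsmul_mem_cylinder (hφ : ¬IsOfFinAddOrder φ) (x : UnitAddCircle)
    (hy : y ∈ cylinder (· + θ) P.letter w) :
    ∃ᶠ m : ℕ in Filter.atTop, x + m • φ ∈ cylinder (· + θ) P.letter w \ {y} := by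
  obtain ⟨ε, hε, hword⟩ := P.exists_forall_circleGap_lt_orbitWord_eq θ y w.length
  refine (frequently_circleGap_add_nsmul_mem_Ioo hφ x y hε).mono fun m hm =>
    ⟨(mem_cylinder_congr (hword _ hm.2)).2 hy, fun hmy => hm.1.ne' ?_⟩
  rw [hmy, circleGap_self]

theorem isSymbolicallyMinimal_rotation (P : CirclePartition k) (hθ : ¬IsOfFinAddOrder θ) :
    IsSymbolicallyMinimal (· + θ) P.letter := by
  rintro w ⟨y, hy⟩ x
  simp only [add_right_iterate]
  exact (frequently_add_nsmul_mem_cylinder hθ x hy).mono fun _ hm => hm.1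

/-! ### Left ends of cylinders -/

/-- The points at which the coding of length `n` under the rotation by `θ` may change. If `θ` maps
a division point to `P.point t`, the point `P.point t - n • θ` already is one of them for `n > 0`;
including it always provides a left end of the cylinder of the empty word as well. -/
def breakpoints (P : CirclePartition k) (θ : UnitAddCircle) (t : Fin k) (n : ℕ) :
    Set UnitAddCircle :=
  {c | c + n • θ = P.point t ∨ ∃ j, ∃ m < n, c + m • θ = P.point j}

variable {s t : Fin k}

theorem breakpoints_mono (h : m ≤ n) : P.breakpoints θ t m ⊆ P.breakpoints θ t n := by
  rintro c (hc | ⟨j, i, hi, hc⟩)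
  · rcases h.eq_or_lt with rfl | hlt
    · exact Or.inl hc
    · exact Or.inr ⟨t, m, hlt, hc⟩
  · exact Or.inr ⟨j, i, hi.trans_le h, hc⟩

theorem point_mem_breakpoints (P : CirclePartition k) (θ : UnitAddCircle) (t : Fin k) (n : ℕ) :
    P.point t ∈ P.breakpoints θ t n :=
  breakpoints_mono n.zero_le (Or.inl (by simp))

theorem finite_breakpoints (P : CirclePartition k) (θ : UnitAddCircle) (t : Fin k) (n : ℕ) :
    (P.breakpoints θ t n).Finite := by
  refine ((Set.finite_range fun q : Fin k × Fin n => P.point q.1 - (q.2 : ℕ) • θ).insert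
    (P.point t - n • θ)).subset ?_
  rintro c (hc | ⟨j, m, hm, hc⟩)
  · exact Or.inl (eq_sub_of_add_eq hc)
  · exact Or.inr ⟨(j, ⟨m, hm⟩), (eq_sub_of_add_eq hc).symm⟩

theorem orbitWord_eq_of_circleGap_le
    (h : ∀ d ∈ P.breakpoints θ t n, circleGap c y ≤ circleGap d y) :
    orbitWord (· + θ) P.letter n c = orbitWord (· + θ) P.letter n y := by
  refine orbitWord_rotation_eq_iff.2 fun m hm => ?_
  have hsplit : ∀ l, circleGap (P.point l) (c + m • θ) + circleGap c y =
      circleGap (P.point l) (y + m • θ) := fun l => by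
    rw [← circleGap_sub_left, ← circleGap_sub_left]
    exact circleGap_add_circleGap (h _ (Or.inr ⟨l, m, hm, sub_add_cancel _ _⟩))
  refine (P.letter_eq_of_circleGap_le fun l => ?_).symm
  rw [← hsplit, ← hsplit]
  gcongr
  exact P.circleGap_letter_le (c + m • θ) l

theorem exists_nearest_breakpoint (P : CirclePartition k) (θ : UnitAddCircle) (t : Fin k) (n : ℕ)
    (y : UnitAddCircle) :
    ∃ c ∈ P.breakpoints θ t n, ∀ d ∈ P.breakpoints θ t n, circleGap c y ≤ circleGap d y :=
  Set.exists_min_image _ _ (P.finite_breakpoints θ t n) ⟨_, P.point_mem_breakpoints θ t n⟩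

theorem exists_mem_breakpoints_orbitWord_eq (P : CirclePartition k) (θ : UnitAddCircle)
    (t : Fin k) (n : ℕ) (y : UnitAddCircle) :
    ∃ c ∈ P.breakpoints θ t n,
      orbitWord (· + θ) P.letter n c = orbitWord (· + θ) P.letter n y := by
  obtain ⟨c, hc, hmin⟩ := P.exists_nearest_breakpoint θ t n y
  exact ⟨c, hc, orbitWord_eq_of_circleGap_le hmin⟩

theorem mem_breakpoints_succ (hc : c ∈ P.breakpoints θ t (n + 1)) :
    c ∈ Set.range P.point ∨ c + θ ∈ P.breakpoints θ t n := by
  rcases hc with hc | ⟨j, _ | m, hm, hc⟩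
  · exact Or.inr (Or.inl (by rw [← hc, succ_nsmul', add_assoc]))
  · exact Or.inl ⟨j, by simpa using hc.symm⟩
  · exact Or.inr (Or.inr ⟨j, m, by omega, by rw [← hc, succ_nsmul', add_assoc]⟩)

/-- Pulled back by the rotation, the left end `q + θ` of the cylinder of `P.point j + θ` lies
between `P.point s` and `P.point j`; as the letter of `q` is `j`, it also lies beyond
`P.point j`. -/
theorem point_eq_of_orbitWord_add_eq (hst : P.point s + θ = P.point t)
    (hinj : Set.InjOn (orbitWord (· + θ) P.letter n) (P.breakpoints θ t n))
    {j : Fin k} {q : UnitAddCircle} (hq : P.letter q = j) (hqn : q + θ ∈ P.breakpoints θ t n)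
    (hword : orbitWord (· + θ) P.letter n (P.point j + θ) = orbitWord (· + θ) P.letter n (q + θ)) :
    P.point j = q := by
  obtain ⟨a, ha, hmin⟩ := P.exists_nearest_breakpoint θ t n (P.point j + θ)
  obtain rfl : a = q + θ := hinj ha hqn ((orbitWord_eq_of_circleGap_le hmin).trans hword)
  have hqj : circleGap q (P.point j) ≤ circleGap (P.point s) (P.point j) := by
    simpa only [← hst, circleGap_add_right] using hmin _ (P.point_mem_breakpoints θ t n)
  have hjq : circleGap (P.point j) q ≤ circleGap (P.point s) q :=
    hq ▸ P.circleGap_letter_le q s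
  exact eq_of_circleGap_le_of_circleGap_le hjq hqj

theorem injOn_orbitWord_breakpoints (hst : P.point s + θ = P.point t) (n : ℕ) :
    Set.InjOn (orbitWord (· + θ) P.letter n) (P.breakpoints θ t n) := by
  induction n with
  | zero =>
    rintro c (hc | ⟨-, m, hm, -⟩) d (hd | ⟨-, m', hm', -⟩) -
    · exact add_right_cancel (hc.trans hd.symm)
    all_goals omega
  | succ n ih =>
    intro c hc d hd hcd
    obtain ⟨hletter, hword⟩ := orbitWord_rotation_succ_eq_iff.1 hcd
    rcases mem_breakpoints_succ hc with ⟨j, rfl⟩ | hcθ <;>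
      rcases mem_breakpoints_succ hd with ⟨l, rfl⟩ | hdθ
    · rw [letter_point, letter_point] at hletter
      rw [hletter]
    · rw [letter_point] at hletter
      exact point_eq_of_orbitWord_add_eq hst ih hletter.symm hdθ hword
    · rw [letter_point] at hletter
      exact (point_eq_of_orbitWord_add_eq hst ih hletter hcθ hword.symm).symm
    · exact add_right_cancel (ih hcθ hdθ hword)

/-! ### Return words -/

/-- The left ends of the sets of points of the cylinder of `w` that share the same coding until the
end of the first return to that cylinder. -/
def returnPoints (P : CirclePartition k) (θ : UnitAddCircle) (t : Fin k) (w : List (Fin k)) :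
    Set UnitAddCircle :=
  {c ∈ cylinder (· + θ) P.letter w |
    c ∈ P.breakpoints θ t (returnTime (· + θ) (cylinder (· + θ) P.letter w) c + w.length)}

theorem encard_returnWords_itinerary (hθ : ¬IsOfFinAddOrder θ) (hst : P.point s + θ = P.point t)
    (x : UnitAddCircle) (w : List (Fin k)) :
    (returnWords (itinerary (· + θ) P.letter x) w).encard = (P.returnPoints θ t w).encard := by
  have hT := P.isSymbolicallyMinimal_rotation hθ
  set C := cylinder (· + θ) P.letter w with hC
  set r := returnTime (· + θ) C with hr
  have hreturn : ∀ c ∈ C, ∃ m, 0 < m ∧ (· + θ)^[m] c ∈ C := fun c hc =>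
    hT.exists_pos_iterate_mem_cylinder ⟨c, hc⟩ c
  have himage : (fun c => orbitWord (· + θ) P.letter (r c) c) '' C =
      (fun c => orbitWord (· + θ) P.letter (r c) c) '' P.returnPoints θ t w := by
    refine Set.Subset.antisymm ?_ (Set.image_mono fun c hc => hc.1)
    rintro _ ⟨c, hc, rfl⟩
    obtain ⟨d, hd, hdc⟩ := P.exists_mem_breakpoints_orbitWord_eq θ t (r c + w.length) c
    have hrd : r d = r c := returnTime_cylinder_congr (hreturn c hc) hdc.symm
    have hdC : d ∈ C := (mem_cylinder_congr (orbitWord_eq_of_le (Nat.le_add_left _ _) hdc)).2 hc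
    refine ⟨d, ⟨hdC, by rwa [← hC, ← hr, hrd]⟩, ?_⟩
    simp only [hrd]
    exact orbitWord_eq_of_le (Nat.le_add_right _ _) hdc
  have hinj : Set.InjOn (fun c => orbitWord (· + θ) P.letter (r c) c)
      (P.returnPoints θ t w) := by
    rintro c ⟨hc, hcb⟩ d ⟨hd, hdb⟩ hcd
    have hrcd : r c = r d := by simpa using congrArg List.length hcd
    have hcC := (isLeast_returnTime (hreturn c hc)).1.2
    have hdC := (isLeast_returnTime (hreturn d hd)).1.2
    simp only [← hC, ← hr, ← hrcd] at hcd hcb hdb hcC hdC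
    exact injOn_orbitWord_breakpoints hst _ hcb hdb
      (orbitWord_add_eq_iff.2 ⟨hcd, orbitWord_eq_of_mem_cylinder hcC hdC⟩)
  rw [hT.returnWords_itinerary, himage, hinj.encard_image]

/-- The rotation by `θ` maps the division point `s` to the division point `t`, and there is no
other relation between the orbits of the division points. For interval exchanges this is Keane's
infinite distinct orbit condition with a single connection. -/
structure IsGenericRotation (P : CirclePartition k) (θ : UnitAddCircle) (s t : Fin k) :
    Prop where
  point_add : P.point s + θ = P.point t
  injOn : Set.InjOn (fun q : Fin k × ℕ => P.point q.1 - q.2 • θ) {q | q.1 ≠ s}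

namespace IsGenericRotation

variable {a : UnitAddCircle} {j l : Fin k} {M : ℕ}

theorem eq_and_eq (H : P.IsGenericRotation θ s t) (hj : j ≠ s) (hl : l ≠ s)
    (h : P.point j - m • θ = P.point l - n • θ) : j = l ∧ m = n :=
  Prod.ext_iff.1 (@H.injOn (j, m) hj (l, n) hl h)

theorem not_isOfFinAddOrder (H : P.IsGenericRotation θ s t) : ¬IsOfFinAddOrder θ := by
  have : Nontrivial (Fin k) := Fin.nontrivial_iff_two_le.2 P.two_le
  obtain ⟨j, hj⟩ := exists_ne s
  rw [isOfFinAddOrder_iff_nsmul_eq_zero]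
  rintro ⟨m, hm, hmθ⟩
  exact hm.ne' (H.eq_and_eq hj hj (n := 0) (by rw [hmθ, zero_nsmul])).2

theorem ne (H : P.IsGenericRotation θ s t) : t ≠ s := by
  rintro rfl
  exact H.not_isOfFinAddOrder (add_eq_left.1 H.point_add ▸ IsOfFinAddOrder.zero)

theorem mem_breakpoints_iff (H : P.IsGenericRotation θ s t) : c ∈ P.breakpoints θ t n ↔
    ∃ j ≠ s, ∃ m < n + if j = t then 1 else 0, P.point j - m • θ = c := by
  constructor
  · rintro (hc | ⟨j, m, hm, hc⟩)
    · exact ⟨t, H.ne, n, by simp, sub_eq_of_eq_add hc.symm⟩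
    · by_cases hj : j = s
      · subst hj
        refine ⟨t, H.ne, m + 1, by simpa using hm, ?_⟩
        rw [← H.point_add, ← hc, succ_nsmul]
        abel
      · exact ⟨j, hj, m, by omega, sub_eq_of_eq_add hc.symm⟩
  · rintro ⟨j, -, m, hm, rfl⟩
    split_ifs at hm with hjt
    · subst hjt
      exact breakpoints_mono (Nat.lt_succ_iff.1 hm) (Or.inl (sub_add_cancel _ _))
    · exact Or.inr ⟨j, m, hm, sub_add_cancel _ _⟩

theorem exists_isLeast_backward_visit (H : P.IsGenericRotation θ s t)
    (haw : a ∈ cylinder (· + θ) P.letter w) (j : Fin k) :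
    ∃ M, IsLeast {m : ℕ | P.point j - m • θ ∈ cylinder (· + θ) P.letter w \ {a}} M := by
  have hneg : ¬IsOfFinAddOrder (-θ) := isOfFinAddOrder_neg_iff.not.2 H.not_isOfFinAddOrder
  obtain ⟨m, hm⟩ := (frequently_add_nsmul_mem_cylinder hneg (P.point j) haw).exists
  rw [smul_neg, ← sub_eq_add_neg] at hm
  exact ⟨_, isLeast_csInf ⟨m, hm⟩⟩

theorem eq_of_mem_returnPoints (H : P.IsGenericRotation θ s t)
    (ha : a ∈ P.breakpoints θ t w.length) (haw : a ∈ cylinder (· + θ) P.letter w)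
    (hj : j ≠ s)
    (hM : IsLeast {m : ℕ | P.point j - m • θ ∈ cylinder (· + θ) P.letter w \ {a}} M)
    (hm : m < returnTime (· + θ) (cylinder (· + θ) P.letter w) (P.point j - m • θ) + w.length +
      if j = t then 1 else 0)
    (hmw : P.point j - m • θ ∈ cylinder (· + θ) P.letter w \ {a}) : m = M := by
  refine le_antisymm (not_lt.1 fun hlt => hM.1.2 ?_) (hM.2 hmw)
  have hvisit : (· + θ)^[m - M] (P.point j - m • θ) = P.point j - M • θ := by
    rw [iterate_add_right_sub_nsmul _ _ (Nat.sub_le m M), Nat.sub_sub_self hlt.le]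
  have hr : returnTime (· + θ) (cylinder (· + θ) P.letter w) (P.point j - m • θ) ≤ m - M :=
    Nat.sInf_le ⟨Nat.sub_pos_of_lt hlt, hvisit ▸ hM.1.1⟩
  have hMb : P.point j - M • θ ∈ P.breakpoints θ t w.length :=
    H.mem_breakpoints_iff.2 ⟨j, hj, M, by omega, rfl⟩
  exact injOn_orbitWord_breakpoints H.point_add _ hMb ha
    (orbitWord_eq_of_mem_cylinder hM.1.1 haw)

theorem point_sub_nsmul_mem_returnPoints (H : P.IsGenericRotation θ s t)
    (ha : a ∈ P.breakpoints θ t w.length) (hj : j ≠ s)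
    (hM : IsLeast {m : ℕ | P.point j - m • θ ∈ cylinder (· + θ) P.letter w \ {a}} M) :
    P.point j - M • θ ∈ P.returnPoints θ t w := by
  refine ⟨hM.1.1, H.mem_breakpoints_iff.2 ⟨j, hj, M, ?_, rfl⟩⟩
  have hT := P.isSymbolicallyMinimal_rotation H.not_isOfFinAddOrder
  obtain ⟨⟨hpos, hret⟩, -⟩ := isLeast_returnTime
    (hT.exists_pos_iterate_mem_cylinder ⟨_, hM.1.1⟩ (P.point j - M • θ))
  set r := returnTime (· + θ) (cylinder (· + θ) P.letter w) (P.point j - M • θ)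
  by_contra! hle
  rw [iterate_add_right_sub_nsmul _ _ (by omega)] at hret
  have hreturn_eq : P.point j - (M - r) • θ = a := by
    by_contra hne
    have := hM.2 ⟨hret, hne⟩
    omega
  obtain ⟨l, hl, m, hm, hlm⟩ := H.mem_breakpoints_iff.1 ha
  obtain ⟨rfl, rfl⟩ := H.eq_and_eq hj hl (hreturn_eq.trans hlm.symm)
  omega

theorem encard_returnPoints (H : P.IsGenericRotation θ s t)
    (hw : (cylinder (· + θ) P.letter w).Nonempty) : (P.returnPoints θ t w).encard = k := by
  obtain ⟨y, hy⟩ := hw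
  obtain ⟨a, ha, hay⟩ := P.exists_mem_breakpoints_orbitWord_eq θ t w.length y
  have haw := (mem_cylinder_congr hay).2 hy
  choose M hM using H.exists_isLeast_backward_visit haw
  have hreturnPoints : P.returnPoints θ t w =
      insert a ((fun j => P.point j - M j • θ) '' (Set.univ \ {s})) := by
    ext c
    constructor
    · rintro ⟨hc, hcb⟩
      refine or_iff_not_imp_left.2 fun hca => ?_
      obtain ⟨j, hj, m, hm, rfl⟩ := H.mem_breakpoints_iff.1 hcb
      obtain rfl := H.eq_of_mem_returnPoints ha haw hj (hM j) hm ⟨hc, hca⟩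
      exact ⟨j, ⟨trivial, hj⟩, rfl⟩
    · rintro (rfl | ⟨j, hj, rfl⟩)
      · exact ⟨haw, breakpoints_mono (Nat.le_add_left _ _) ha⟩
      · exact H.point_sub_nsmul_mem_returnPoints ha hj.2 (hM j)
  have hinj : Set.InjOn (fun j => P.point j - M j • θ) (Set.univ \ {s}) :=
    fun j hj l hl h => (H.eq_and_eq hj.2 hl.2 h).1
  have ha_notMem : a ∉ (fun j => P.point j - M j • θ) '' (Set.univ \ {s}) := by
    rintro ⟨j, -, hj⟩
    exact (hM j).1.2 hj
  rw [hreturnPoints, Set.encard_insert_of_notMem ha_notMem, hinj.encard_image,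
    Set.encard_sdiff_singleton_add_one (Set.mem_univ s)]
  simp

end IsGenericRotation

/-! ### Rationally independent lengths -/

theorem exists_rightEnd_eq (P : CirclePartition k) (i : Fin k) :
    ∃ j ≠ i, P.rightEnd i = P.pt j ∨ P.rightEnd i = P.pt j + 1 := by
  have hk := P.two_le
  unfold rightEnd
  split_ifs with h
  · exact ⟨_, by simp [Fin.ext_iff], Or.inl rfl⟩
  · exact ⟨P.first, by simp only [first, ne_eq, Fin.ext_iff]; omega, Or.inr rfl⟩

theorem exists_point_add_length_eq (P : CirclePartition k) (i : Fin k) :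
    ∃ j ≠ i, P.point i + (P.length i : UnitAddCircle) = P.point j := by
  obtain ⟨j, hji, hj⟩ := P.exists_rightEnd_eq i
  refine ⟨j, hji, ?_⟩
  rw [point, ← AddCircle.coe_add, length, add_sub_cancel]
  rcases hj with hj | hj
  · rw [hj, point]
  · rw [hj, AddCircle.coe_add_period, point]

theorem linearIndependent_update_pt_sub_pt (P : CirclePartition k)
    (hind : LinearIndependent ℚ P.length) (s : Fin k) :
    LinearIndependent ℚ (Function.update (fun j => P.pt j - P.pt s) s 1) := by
  set v := Function.update (fun j => P.pt j - P.pt s) s 1 with hv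
  have hone : (1 : ℝ) ∈ Submodule.span ℚ (Set.range v) :=
    Submodule.subset_span ⟨s, by simp [hv]⟩
  have hpt : ∀ j, P.pt j - P.pt s ∈ Submodule.span ℚ (Set.range v) := fun j => by
    rcases eq_or_ne j s with rfl | hj
    · simp
    · exact Submodule.subset_span ⟨j, by simp [hv, hj]⟩
  have hlength : Set.range P.length ⊆ Submodule.span ℚ (Set.range v) := by
    rintro _ ⟨i, rfl⟩
    obtain ⟨j, -, hj⟩ := P.exists_rightEnd_eq i
    have hdiff := Submodule.sub_mem _ (hpt j) (hpt i)
    rw [sub_sub_sub_cancel_right] at hdiff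
    rcases hj with hj | hj
    · rwa [SetLike.mem_coe, length, hj]
    · rw [SetLike.mem_coe, length, hj, add_sub_right_comm]
      exact Submodule.add_mem _ hdiff hone
  have := FiniteDimensional.span_of_finite ℚ (Set.finite_range v)
  rw [linearIndependent_iff_card_le_finrank_span, ← finrank_span_eq_card hind]
  exact Submodule.finrank_mono (Submodule.span_le.2 hlength)

theorem eq_and_eq_zero_of_pt_sub_pt_eq (P : CirclePartition k)
    (hind : LinearIndependent ℚ P.length) {j l : Fin k} (hj : j ≠ s) (hl : l ≠ s) (ht : t ≠ s)
    {q N : ℤ} (h : P.pt j - P.pt l = q * (P.pt t - P.pt s) + N) : j = l ∧ q = 0 := by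
  set v := Function.update (fun j => P.pt j - P.pt s) s 1 with hv
  set f : Fin k →₀ ℚ := Finsupp.single j 1 - Finsupp.single l 1 -
    Finsupp.single t (q : ℚ) - Finsupp.single s (N : ℚ) with hf
  have hcomb : Finsupp.linearCombination ℚ v f = 0 := by
    simp only [hf, hv, map_sub, Finsupp.linearCombination_single, Function.update_self, ne_eq, hj,
      hl, ht, not_false_eq_true, Function.update_of_ne, Rat.smul_def, Rat.cast_one, one_mul,
      Rat.cast_intCast, mul_one]
    linarith
  have hf0 : f = 0 := linearIndependent_iff.1 (P.linearIndependent_update_pt_sub_pt hind s) f hcomb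
  have hcoeff : ∀ u ≠ s, (if j = u then 1 else 0) - (if l = u then 1 else 0) -
      (if t = u then (q : ℚ) else 0) = 0 := fun u hu => by
    simpa [hf, Finsupp.single_apply, hu.symm] using DFunLike.congr_fun hf0 u
  obtain rfl : j = l := by
    -- One of `j` and `l` differs from `t`; the coefficient there is `±1`.
    by_contra hjl
    have hcoeff_j := hcoeff j hj
    have hcoeff_l := hcoeff l hl
    grind
  exact ⟨rfl, by simpa using hcoeff t ht⟩

theorem isGenericRotation_point_sub_point (P : CirclePartition k)
    (hind : LinearIndependent ℚ P.length) (ht : t ≠ s) :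
    P.IsGenericRotation (P.point t - P.point s) s t := by
  refine ⟨add_sub_cancel _ _, ?_⟩
  rintro ⟨j, m⟩ hj ⟨l, n⟩ hl (h : P.point j - m • _ = P.point l - n • _)
  have hcoe : (((P.pt j - m • (P.pt t - P.pt s)) - (P.pt l - n • (P.pt t - P.pt s)) : ℝ) :
      UnitAddCircle) = 0 := sub_eq_zero.2 h
  obtain ⟨N, hN⟩ := (AddCircle.coe_eq_zero_iff 1).1 hcoe
  have hrelation : P.pt j - P.pt l = ((m - n : ℤ) : ℝ) * (P.pt t - P.pt s) + N := by
    simp only [zsmul_eq_mul, nsmul_eq_mul, mul_one] at hN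
    push_cast
    linarith
  obtain ⟨rfl, hmn⟩ := P.eq_and_eq_zero_of_pt_sub_pt_eq hind hj hl ht hrelation
  rw [Prod.mk_right_inj]
  omega

theorem exists_isGenericRotation (P : CirclePartition k) (hind : LinearIndependent ℚ P.length)
    {α : ℝ} (hα : ∃ i, α = P.length i ∨ α = -P.length i) :
    ∃ s t, P.IsGenericRotation α s t := by
  obtain ⟨i, hα⟩ := hα
  obtain ⟨j, hji, hij⟩ := P.exists_point_add_length_eq i
  have hlength : (P.length i : UnitAddCircle) = P.point j - P.point i := eq_sub_of_add_eq' hij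
  rcases hα with rfl | rfl
  · exact ⟨i, j, hlength ▸ P.isGenericRotation_point_sub_point hind hji⟩
  · refine ⟨j, i, ?_⟩
    rw [AddCircle.coe_neg, hlength, neg_sub]
    exact P.isGenericRotation_point_sub_point hind hji.symm

end CirclePartition

theorem mainTheorem4_general {k : ℕ} {P : CirclePartition k} {α : ℝ} {s t : Fin k}
    (H : P.IsGenericRotation α s t) (x : UnitAddCircle) :
    IsRecurrentWord (P.coding α x) ∧ HasPropertyR k (P.coding α x) := by
  rw [P.coding_eq_itinerary]
  refine ⟨(P.isSymbolicallyMinimal_rotation H.not_isOfFinAddOrder).isRecurrentWord_itinerary x, ?_⟩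
  rintro w ⟨i, hi⟩
  rw [P.encard_returnWords_itinerary H.not_isOfFinAddOrder H.point_add]
  exact H.encard_returnPoints ⟨_, occursAt_itinerary_iff.1 hi⟩

theorem mainTheorem4 (k : ℕ) (P : CirclePartition k)
    (hind : LinearIndependent ℚ P.length)
    (α : ℝ) (hα : ∃ i : Fin k, α = P.length i ∨ α = -P.length i)
    (x : UnitAddCircle) :
    IsRecurrentWord (P.coding α x) ∧ HasPropertyR k (P.coding α x) := by
  obtain ⟨s, t, H⟩ := P.exists_isGenericRotation hind hα
  exact mainTheorem4_general H x
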